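/- Let $N\ge 0$ be an integer, let $\mathscr M(\mathbb R^N)$ be the space of finite signed Borel measures on $\mathbb R^N$, and let $H:\mathbb R^N\times\mathbb R\to[0,+\infty]$ be a function such that $H(x,0)=0$ for every $x$ and such that, for every $x$, $m\mapsto H(x,m)$ is concave on $(0,+\infty)$ and on $(-\infty,0)$. Let $$H_{\mathrm{lsc}}(x,m)=\sup\{G(x,m)\;:\;G:\mathbb R^N\times\mathbb R\to[0,+\infty]\text{ lower semicontinuous},\ G\le H\}$$ be the lower semicontinuous envelope of $H$. For $u\in\mathscr M(\mathbb R^N)$ put $$\mathbf M^H_{\mathrm{atom}}(u)=\begin{cases}\sum_{i=1}^kH(x_i,m_i)&\text{if }u=\sum_{i=1}^km_i\delta_{x_i}\text{ with finitely many distinct points }x_i\in\mathbb R^N\text{ and }m_i\in\mathbb R,\\+\infty&\text{otherwise.}\end{cases}$$ For a Borel function $K:\mathbb R^N\times\mathbb R\to[0,+\infty]$ whose slopes $K'(x,0^\pm)=\lim_{m\to0^\pm}K(x,m)/|m|\in[0,+\infty]$ exist for every $x$, put $$\mathbf M^K(u)=\sum_{x\in\mathbb R^N}K(x,u(\{x\}))+\int_{\mathbb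 R^N}K'(x,0^+)\,du^d_+(x)+\int_{\mathbb R^N}K'(x,0^-)\,du^d_-(x),$$ where $u^d$ is the diffuse (non-atomic) part of $u$ and $u^d=u^d_+-u^d_-$ is its Jordan decomposition. A functional $F:\mathscr M(\mathbb R^N)\to[0,+\infty]$ is called sequentially narrowly lower semicontinuous if $F(u)\le\liminf_{n\to\infty}F(u_n)$ whenever $\int f\,du_n\to\int f\,du$ for every bounded continuous $f:\mathbb R^N\to\mathbb R$. Then $H_{\mathrm{lsc}}$ is Borel and its slopes $H_{\mathrm{lsc}}'(x,0^\pm)$ exist in $[0,+\infty]$ for every $x$, so that $\mathbf M^{H_{\mathrm{lsc}}}$ is well defined, and $\mathbf M^{H_{\mathrm{lsc}}}$ is the sequentially narrowly lower semicontinuous envelope of $\mathbf M^H_{\mathrm{atom}}$: for every $u\in\mathscr M(\mathbb R^N)$, $$\mathbf M^{H_{\mathrm{lsc}}}(u)=\sup\bigl\{F(u)\;:\;F:\mathscr M(\mathbb R^N)\to[0,+\infty]\text{ sequentially narrowly lower semicontinuous},\ F\le\mathbf M^H_{\mathrm{atom}}\bigr\}.$$ -/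

import Mathlib

open Filter Topology MeasureTheory Set
open scoped ENNReal NNReal BoundedContinuousFunction

noncomputable section

namespace HMass

/-- Euclidean space `ℝ^N`. -/
abbrev E (N : ℕ) : Type := EuclideanSpace ℝ (Fin N)

/-- `H : ℝ^N × ℝ → [0,+∞]` is mass-concave if, for every `x`, the function `H (x, ·)` is concave
on `(0,+∞)` and on `(-∞,0)`. (`[0,+∞]` carries an action of the nonnegative reals, so the
coefficients of the convex combinations are taken in `ℝ≥0`.) -/
def MassConcave {N : ℕ} (H : E N × ℝ → ℝ≥0∞) : Prop :=
  ∀ x, ConcaveOn ℝ≥0 (Ioi (0 : ℝ)) (fun m => H (x, m)) ∧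
    ConcaveOn ℝ≥0 (Iio (0 : ℝ)) (fun m => H (x, m))

/-- The lower semicontinuous envelope of `H`: the supremum of its lower semicontinuous
minorants. -/
def lscEnvelope {N : ℕ} (H : E N × ℝ → ℝ≥0∞) : E N × ℝ → ℝ≥0∞ :=
  sSup {G | G ≤ H ∧ LowerSemicontinuous G}

/-- The right slope `H'(x,0⁺) = lim_{m → 0⁺} H(x,m)/|m|`. -/
def rightSlope {N : ℕ} (H : E N × ℝ → ℝ≥0∞) (x : E N) : ℝ≥0∞ :=
  limUnder (𝓝[>] (0 : ℝ)) fun m => H (x, m) / ENNReal.ofReal |m|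

/-- The left slope `H'(x,0⁻) = lim_{m → 0⁻} H(x,m)/|m|`. -/
def leftSlope {N : ℕ} (H : E N × ℝ → ℝ≥0∞) (x : E N) : ℝ≥0∞ :=
  limUnder (𝓝[<] (0 : ℝ)) fun m => H (x, m) / ENNReal.ofReal |m|

/-- The conditions under which the `H`-mass is defined: `H` is Borel and both slopes at the origin
exist in `[0,+∞]`. -/
structure IsAdmissible {N : ℕ} (H : E N × ℝ → ℝ≥0∞) : Prop where
  measurable : Measurable H
  tendsto_rightSlope : ∀ x, Tendsto (fun m => H (x, m) / ENNReal.ofReal |m|)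
    (𝓝[>] (0 : ℝ)) (𝓝 (rightSlope H x))
  tendsto_leftSlope : ∀ x, Tendsto (fun m => H (x, m) / ENNReal.ofReal |m|)
    (𝓝[<] (0 : ℝ)) (𝓝 (leftSlope H x))

/-- The set of atoms of a finite signed Borel measure. -/
def atoms {N : ℕ} (u : SignedMeasure (E N)) : Set (E N) := {x | u {x} ≠ 0}

theorem countable_atoms {N : ℕ} (u : SignedMeasure (E N)) : (atoms u).Countable := by
  have h := Measure.countable_meas_pos_of_disjoint_iUnion (μ := u.totalVariation)
    (As := fun x : E N => ({x} : Set (E N))) (fun x => measurableSet_singleton x)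
    (fun x y hxy => by simpa [Function.onFun] using hxy)
  refine h.mono fun x hx => ?_
  have h1 := u.enorm_le_totalVariation {x}
  exact lt_of_lt_of_le (enorm_pos.2 hx) h1

theorem measurableSet_atoms {N : ℕ} (u : SignedMeasure (E N)) : MeasurableSet (atoms u) :=
  (countable_atoms u).measurableSet

/-- The diffuse part `u^d` of `u`: its restriction to the complement of the (countable, hence
measurable) set of atoms. The atomic part `u^a = u - u^d` is the restriction to the atoms. -/
def diffusePart {N : ℕ} (u : SignedMeasure (E N)) : SignedMeasure (E N) :=
  u.restrict (atoms u)ᶜ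

/-- The `H`-mass `∫ H(x,u({x})) dℋ⁰(x) + ∫ H'(x,0⁺) du^d_+(x) + ∫ H'(x,0⁻) du^d_-(x)` of a finite
signed Borel measure `u`, where `ℋ⁰` is the counting measure and `u^d = u^d_+ - u^d_-` is the
Jordan decomposition of the diffuse part. -/
def massH {N : ℕ} (H : E N × ℝ → ℝ≥0∞) (u : SignedMeasure (E N)) : ℝ≥0∞ :=
  ∫⁻ x, H (x, u {x}) ∂Measure.count
    + ∫⁻ x, rightSlope H x ∂(diffusePart u).toJordanDecomposition.posPart
    + ∫⁻ x, leftSlope H x ∂(diffusePart u).toJordanDecomposition.negPart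

/-- The atomic functional: `∑ i, H (x_i, m_i)` if `u = ∑ i, m_i δ_{x_i}` for finitely many distinct
points `x_i` and reals `m_i`, and `+∞` (the infimum over the empty set) if `u` is not of this form.
Two such representations of `u` differ only by terms with `m_i = 0`, so for `H(·,0) = 0` the value
does not depend on the representation, see `massAtom_sum_dirac`. -/
def massAtom {N : ℕ} (H : E N × ℝ → ℝ≥0∞) (u : SignedMeasure (E N)) : ℝ≥0∞ :=
  ⨅ (s : Finset (E N)) (m : E N → ℝ) (_ : u = ∑ x ∈ s, VectorMeasure.dirac x (m x)),
    ∑ x ∈ s, H (x, m x)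

theorem sum_dirac_singleton {N : ℕ} (s : Finset (E N)) (m : E N → ℝ) (y : E N) :
    (∑ x ∈ s, VectorMeasure.dirac x (m x) : SignedMeasure (E N)) {y}
      = (s : Set (E N)).indicator m y := by
  classical
  have h : ∀ x ∈ s, (VectorMeasure.dirac x (m x) : SignedMeasure (E N)) {y}
      = if x = y then m y else 0 := by
    intro x _
    split_ifs with hxy
    · subst hxy
      exact VectorMeasure.dirac_apply_of_mem (measurableSet_singleton _) (mem_singleton _)
    · exact VectorMeasure.dirac_apply_of_notMem (by simpa using hxy)
  simp only [_root_.sum_apply, indicator, Finset.mem_coe]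
  rw [Finset.sum_congr rfl h, Finset.sum_ite_eq' s y]

theorem massAtom_sum_dirac {N : ℕ} (H : E N × ℝ → ℝ≥0∞) (H0 : ∀ x, H (x, 0) = 0)
    (s : Finset (E N)) (m : E N → ℝ) :
    massAtom H (∑ x ∈ s, VectorMeasure.dirac x (m x)) = ∑ x ∈ s, H (x, m x) := by
  have key : ∀ (s : Finset (E N)) (m : E N → ℝ), ∑ x ∈ s, H (x, m x)
      = ∑' y, H (y, (∑ x ∈ s, VectorMeasure.dirac x (m x) : SignedMeasure (E N)) {y}) := by
    intro s m
    rw [tsum_eq_sum (s := s)]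
    · refine Finset.sum_congr rfl fun x hx => ?_
      rw [sum_dirac_singleton, indicator_of_mem (by simpa using hx)]
    · intro x hx
      rw [sum_dirac_singleton, indicator_of_notMem (by simpa using hx), H0]
  refine le_antisymm (iInf_le_of_le s <| iInf_le_of_le m <| iInf_le_of_le rfl le_rfl) ?_
  refine le_iInf fun t => le_iInf fun n => le_iInf fun h => ?_
  rw [key s m, key t n, h]

/-- Narrow convergence of a sequence of finite signed measures: convergence in duality with the
bounded continuous functions. -/
def NarrowTendsto {N : ℕ} (v : ℕ → SignedMeasure (E N)) (u : SignedMeasure (E N)) : Prop :=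
  ∀ f : E N →ᵇ ℝ, Tendsto (fun n => ∫ᵛ x, f x ∂<•(v n)) atTop (𝓝 (∫ᵛ x, f x ∂<•u))

/-- Sequential lower semicontinuity with respect to narrow convergence. -/
def SeqNarrowLsc {N : ℕ} (F : SignedMeasure (E N) → ℝ≥0∞) : Prop :=
  ∀ (v : ℕ → SignedMeasure (E N)) (u : SignedMeasure (E N)), NarrowTendsto v u →
    F u ≤ liminf (fun n => F (v n)) atTop

/-- The sequentially narrowly lower semicontinuous envelope of a functional: the supremum of its
sequentially narrowly lower semicontinuous minorants. -/
def seqNarrowLscEnvelope {N : ℕ} (Φ : SignedMeasure (E N) → ℝ≥0∞) :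
    SignedMeasure (E N) → ℝ≥0∞ :=
  sSup {F | F ≤ Φ ∧ SeqNarrowLsc F}

end HMass

end

/-!
Concavity on the two half-lines is used only through *ray-concavity*: along each half-line
`H (x, ·)` is nondecreasing and its slope is nonincreasing. This property is inherited by the lower
semicontinuous envelope `K` of `H`, and it makes the functions `K (x, ·)` subadditive, with slopes
at `0` that are suprema of secant slopes.

*The mass `M^K` is lower semicontinuous.* Write `M^K (u)` as the sum of the masses of `u⁺` and `u⁻`.
The mass of a positive measure `μ` is at most the integral against `μ` of the suprema of
`K (x, t) / t` over `t > μ {x}`. By lower semicontinuity of `K` this integrand is a countable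
supremum of constants `c` on open sets `A` such that `c ≤ K (y, t) / t` on `A` for some `t > μ A`;
for each of them the mass on `A` controls `c u⁺` along narrow limits. The lower limit of the masses
is superadditive on disjoint open sets, which allows the countable supremum to be localized.

*It is the largest minorant.* The envelope `F` of the atomic functional is subadditive because the
atomic functional is, and `F (m δ_x) ≤ K (x, m)` because `(x, m) ↦ F (m δ_x)` is lower
semicontinuous. Summing over the atoms of `u`, and approximating the two diffuse parts of `u` by
atomic measures placed at points where the slope does not exceed its average over a small cell,
gives `F ≤ M^K`.
-/

noncomputable section

namespace HMass

/-! ### Ray-concave functions -/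

/-- A function `ℝ → [0,+∞]` that vanishes at `0`, is nondecreasing in `|m|` on each half-line, and
whose slope `f m / |m|` is nonincreasing there. The last two conditions are the cases `1 ≤ l` and
`l ≤ 1` of `min_one_mul_le`. Unlike concavity on the two half-lines, which implies it, this property
passes to lower semicontinuous envelopes in the pair `(x, m)`. -/
structure RayConcave (f : ℝ → ℝ≥0∞) : Prop where
  map_zero : f 0 = 0
  min_one_mul_le : ∀ (l : ℝ≥0) (m : ℝ), min 1 (l : ℝ≥0∞) * f m ≤ f (l * m)

theorem mul_le_of_concaveOn_Ioi {f : ℝ → ℝ≥0∞} (hf : ConcaveOn ℝ≥0 (Ioi 0) f) {b : ℝ≥0}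
    (hb : b < 1) {m m' : ℝ} (hm : 0 < m) (hbm : b * m < m') : (b : ℝ≥0∞) * f m ≤ f m' := by
  have hb' : 0 < (1 : ℝ) - b := sub_pos.2 (by exact_mod_cast hb)
  have hcomb : b • m + (1 - b) • ((m' - b * m) / (1 - b)) = m' := by
    simp only [NNReal.smul_def, NNReal.coe_sub hb.le, NNReal.coe_one, smul_eq_mul]
    field_simp
    ring
  have hconc := hf.2 (mem_Ioi.2 hm) (mem_Ioi.2 (div_pos (sub_pos.2 hbm) hb')) zero_le zero_le
    (add_tsub_cancel_of_le hb.le)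
  rw [hcomb] at hconc
  exact le_self_add.trans hconc

theorem min_one_mul_le_of_concaveOn_Ioi {f : ℝ → ℝ≥0∞} (hf : ConcaveOn ℝ≥0 (Ioi 0) f) (l : ℝ≥0)
    {m : ℝ} (hm : 0 < m) : min 1 (l : ℝ≥0∞) * f m ≤ f (l * m) := by
  refine ENNReal.mul_le_of_forall_lt fun b hb c hc => ?_
  lift b to ℝ≥0 using (hb.trans_le le_top).ne
  obtain ⟨hb1, hbl⟩ : b < 1 ∧ b < l := by exact_mod_cast lt_min_iff.1 hb
  calc (b : ℝ≥0∞) * c ≤ b * f m := by gcongr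
    _ ≤ f (l * m) := mul_le_of_concaveOn_Ioi hf hb1 hm (by gcongr)

theorem concaveOn_comp_neg {f : ℝ → ℝ≥0∞} (hf : ConcaveOn ℝ≥0 (Iio 0) f) :
    ConcaveOn ℝ≥0 (Ioi 0) fun m => f (-m) := by
  refine ⟨convex_Ioi 0, fun m hm n hn a b ha hb hab => ?_⟩
  have h := hf.2 (mem_Iio.2 (neg_lt_zero.2 hm)) (mem_Iio.2 (neg_lt_zero.2 hn)) ha hb hab
  rwa [smul_neg, smul_neg, ← neg_add] at h

theorem RayConcave.of_concaveOn {f : ℝ → ℝ≥0∞} (h0 : f 0 = 0) (hpos : ConcaveOn ℝ≥0 (Ioi 0) f)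
    (hneg : ConcaveOn ℝ≥0 (Iio 0) f) : RayConcave f := by
  refine ⟨h0, fun l m => ?_⟩
  rcases lt_trichotomy m 0 with hm | rfl | hm
  · simpa using min_one_mul_le_of_concaveOn_Ioi (concaveOn_comp_neg hneg) l (neg_pos.2 hm)
  · simp [h0]
  · exact min_one_mul_le_of_concaveOn_Ioi hpos l hm

/-- The supremum of the slopes `f t / t` over `t > m`. For ray-concave `f`, the value at `m = 0` is
the slope of `f` at `0⁺`. -/
def secantSlope (f : ℝ → ℝ≥0∞) (m : ℝ) : ℝ≥0∞ := ⨆ t ∈ Ioi m, f t / ENNReal.ofReal t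

theorem le_secantSlope_mul_of_lt (f : ℝ → ℝ≥0∞) {m t : ℝ} (hm : 0 ≤ m) (h : m < t) :
    f t ≤ secantSlope f m * ENNReal.ofReal t := by
  rw [← ENNReal.div_le_iff (by simpa using hm.trans_lt h) ENNReal.ofReal_ne_top]
  exact le_biSup (fun t => f t / ENNReal.ofReal t) h

namespace RayConcave

variable {f : ℝ → ℝ≥0∞}

theorem comp_neg (hf : RayConcave f) : RayConcave fun m => f (-m) :=
  ⟨by simp [hf.map_zero], fun l m => by simpa using hf.min_one_mul_le l (-m)⟩

theorem min_one_mul_le_of_pos (hf : RayConcave f) {m m' : ℝ} (hm : 0 < m) (hm' : 0 ≤ m') :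
    min 1 (ENNReal.ofReal (m' / m)) * f m ≤ f m' := by
  have h := hf.min_one_mul_le (m' / m).toNNReal m
  rwa [Real.coe_toNNReal _ (by positivity), div_mul_cancel₀ _ hm.ne'] at h

theorem monotoneOn (hf : RayConcave f) : MonotoneOn f (Ici 0) := by
  intro m hm m' _ h
  rcases (mem_Ici.1 hm).eq_or_lt with rfl | hm
  · simp [hf.map_zero]
  · have hle := hf.min_one_mul_le_of_pos hm (hm.le.trans h)
    rwa [min_eq_left (ENNReal.one_le_ofReal.2 ((one_le_div hm).2 h)), one_mul] at hle

theorem antitoneOn_div_ofReal (hf : RayConcave f) :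
    AntitoneOn (fun m => f m / ENNReal.ofReal m) (Ioi 0) := by
  intro m (hm : 0 < m) m' (hm' : 0 < m') h
  have hle := hf.min_one_mul_le_of_pos hm' hm.le
  rw [min_eq_right (ENNReal.ofReal_le_one.2 ((div_le_one hm').2 h)),
    ENNReal.ofReal_div_of_pos hm'] at hle
  rw [ENNReal.le_div_iff_mul_le (by simp [hm]) (by simp)]
  calc f m' / ENNReal.ofReal m' * ENNReal.ofReal m
      = ENNReal.ofReal m / ENNReal.ofReal m' * f m' := by simp only [div_eq_mul_inv]; ring
    _ ≤ f m := hle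

theorem mul_ofReal_le (hf : RayConcave f) {c : ℝ≥0∞} {m t : ℝ} (hm : 0 ≤ m) (h : m ≤ t)
    (hc : c ≤ f t / ENNReal.ofReal t) : c * ENNReal.ofReal m ≤ f m := by
  rcases hm.eq_or_lt with rfl | hm
  · simp
  · rw [← ENNReal.le_div_iff_mul_le (by simp [hm]) (by simp)]
    exact hc.trans (hf.antitoneOn_div_ofReal hm (hm.trans_le h) h)

theorem add_le_of_nonneg (hf : RayConcave f) {m m' : ℝ} (hm : 0 ≤ m) (hm' : 0 ≤ m') :
    f (m + m') ≤ f m + f m' := by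
  rcases (add_nonneg hm hm').eq_or_lt with h | h
  · simp [← h, hf.map_zero]
  calc f (m + m')
      = f (m + m') / ENNReal.ofReal (m + m') * ENNReal.ofReal (m + m') :=
        (ENNReal.div_mul_cancel (by simpa using h) ENNReal.ofReal_ne_top).symm
    _ = f (m + m') / ENNReal.ofReal (m + m') * ENNReal.ofReal m
          + f (m + m') / ENNReal.ofReal (m + m') * ENNReal.ofReal m' := by
        rw [ENNReal.ofReal_add hm hm', mul_add]
    _ ≤ f m + f m' := add_le_add (hf.mul_ofReal_le hm (by linarith) le_rfl)
        (hf.mul_ofReal_le hm' (by linarith) le_rfl)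

theorem add_le_of_add_nonneg (hf : RayConcave f) {m m' : ℝ} (h : 0 ≤ m + m') :
    f (m + m') ≤ f m + f m' := by
  rcases le_total m 0 with hm | hm
  · exact (hf.monotoneOn h (mem_Ici.2 (by linarith)) (by linarith)).trans le_add_self
  rcases le_total m' 0 with hm' | hm'
  · exact (hf.monotoneOn h hm (by linarith)).trans le_self_add
  · exact hf.add_le_of_nonneg hm hm'

theorem add_le (hf : RayConcave f) (m m' : ℝ) : f (m + m') ≤ f m + f m' := by
  rcases le_total 0 (m + m') with h | h
  · exact hf.add_le_of_add_nonneg h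
  · simpa [add_comm] using hf.comp_neg.add_le_of_add_nonneg (m := -m) (m' := -m') (by linarith)

theorem le_secantSlope_zero_mul (hf : RayConcave f) {m : ℝ} (hm : 0 ≤ m) :
    f m ≤ secantSlope f 0 * ENNReal.ofReal m := by
  rcases hm.eq_or_lt with rfl | hm
  · simp [hf.map_zero]
  · exact le_secantSlope_mul_of_lt f le_rfl hm

theorem le_secantSlope_mul (hf : RayConcave f) (hlsc : LowerSemicontinuous f) {m : ℝ}
    (hm : 0 ≤ m) : f m ≤ secantSlope f m * ENNReal.ofReal m := by
  rcases hm.eq_or_lt with rfl | hm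
  · simp [hf.map_zero]
  have hlim : Tendsto (fun t => secantSlope f m * ENNReal.ofReal t) (𝓝[>] m)
      (𝓝 (secantSlope f m * ENNReal.ofReal m)) :=
    (ENNReal.Tendsto.const_mul (ENNReal.continuous_ofReal.tendsto m)
      (Or.inl (by simpa using hm))).mono_left nhdsWithin_le_nhds
  refine le_of_forall_lt_imp_le_of_dense fun c hc => ge_of_tendsto hlim ?_
  filter_upwards [(hlsc m c hc).filter_mono nhdsWithin_le_nhds, self_mem_nhdsWithin] with t hct hmt
  exact hct.le.trans (le_secantSlope_mul_of_lt f hm.le hmt)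

theorem tendsto_secantSlope_zero (hf : RayConcave f) :
    Tendsto (fun m => f m / ENNReal.ofReal m) (𝓝[>] 0) (𝓝 (secantSlope f 0)) := by
  rw [secantSlope, ← sSup_image]
  exact hf.antitoneOn_div_ofReal.tendsto_nhdsGT (OrderTop.bddAbove _)

theorem tendsto_div_ofReal_abs_nhdsGT (hf : RayConcave f) :
    Tendsto (fun m => f m / ENNReal.ofReal |m|) (𝓝[>] 0) (𝓝 (secantSlope f 0)) := by
  refine hf.tendsto_secantSlope_zero.congr' ?_
  filter_upwards [self_mem_nhdsWithin] with m hm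
  rw [abs_of_pos hm]

theorem tendsto_div_ofReal_abs_nhdsLT (hf : RayConcave f) :
    Tendsto (fun m => f m / ENNReal.ofReal |m|) (𝓝[<] 0)
      (𝓝 (secantSlope (fun m => f (-m)) 0)) := by
  have hneg : Tendsto (fun m : ℝ => -m) (𝓝[<] 0) (𝓝[>] 0) := by
    simpa using tendsto_neg_nhdsLT (a := (0 : ℝ))
  simpa [Function.comp_def] using hf.comp_neg.tendsto_div_ofReal_abs_nhdsGT.comp hneg

end RayConcave

theorem lowerSemicontinuous_secantSlope {X : Type*} [TopologicalSpace X] {K : X × ℝ → ℝ≥0∞}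
    (hK : LowerSemicontinuous K) {m : ℝ} (hm : 0 ≤ m) :
    LowerSemicontinuous fun x => secantSlope (fun t => K (x, t)) m := by
  refine lowerSemicontinuous_biSup fun t ht => ?_
  have hdiv : Continuous fun a : ℝ≥0∞ => a / ENNReal.ofReal t :=
    ENNReal.continuous_div_const _ (by simpa using hm.trans_lt ht)
  exact hdiv.comp_lowerSemicontinuous (hK.comp (by fun_prop)) fun _ _ h =>
    ENNReal.div_le_div_right h _

section Slopes

variable {N : ℕ} {K : E N × ℝ → ℝ≥0∞}

theorem rightSlope_eq_secantSlope {x : E N} (hK : RayConcave fun m => K (x, m)) :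
    rightSlope K x = secantSlope (fun m => K (x, m)) 0 :=
  hK.tendsto_div_ofReal_abs_nhdsGT.limUnder_eq

theorem leftSlope_eq_secantSlope {x : E N} (hK : RayConcave fun m => K (x, m)) :
    leftSlope K x = secantSlope (fun m => K (x, -m)) 0 :=
  hK.tendsto_div_ofReal_abs_nhdsLT.limUnder_eq

theorem isAdmissible_of_rayConcave (hmeas : Measurable K)
    (hK : ∀ x, RayConcave fun m => K (x, m)) : IsAdmissible K where
  measurable := hmeas
  tendsto_rightSlope x := by
    rw [rightSlope_eq_secantSlope (hK x)]
    exact (hK x).tendsto_div_ofReal_abs_nhdsGT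
  tendsto_leftSlope x := by
    rw [leftSlope_eq_secantSlope (hK x)]
    exact (hK x).tendsto_div_ofReal_abs_nhdsLT

end Slopes

/-! ### Jordan decompositions -/

section Jordan

variable {X : Type*} [MeasurableSpace X]

/-- The positive part `u⁺` of the Jordan decomposition of `u`. -/
abbrev posPart (u : SignedMeasure X) : Measure X := u.toJordanDecomposition.posPart

/-- The negative part `u⁻` of the Jordan decomposition of `u`. -/
abbrev negPart (u : SignedMeasure X) : Measure X := u.toJordanDecomposition.negPart

theorem posPart_sub_negPart (u : SignedMeasure X) :
    (posPart u).toSignedMeasure - (negPart u).toSignedMeasure = u :=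
  u.toSignedMeasure_toJordanDecomposition

theorem posPart_neg (u : SignedMeasure X) : posPart (-u) = negPart u := by
  simp [posPart, negPart, SignedMeasure.toJordanDecomposition_neg]

theorem exists_measurableSet_negPart_eq_zero (u : SignedMeasure X) :
    ∃ P, MeasurableSet P ∧ negPart u P = 0 ∧ posPart u Pᶜ = 0 := by
  obtain ⟨P, hP, hpos, hneg⟩ := u.toJordanDecomposition.mutuallySingular
  exact ⟨Pᶜ, hP.compl, hneg, by simpa using hpos⟩

theorem posPart_restrict (u : SignedMeasure X) {s : Set X} (hs : MeasurableSet s) :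
    posPart (u.restrict s) = (posPart u).restrict s := by
  let j : JordanDecomposition X :=
    { posPart := (posPart u).restrict s
      negPart := (negPart u).restrict s
      posPart_finite := inferInstance
      negPart_finite := inferInstance
      mutuallySingular :=
        ((u.toJordanDecomposition.mutuallySingular.restrict s).symm.restrict s).symm }
  have hj : u.restrict s = j.toSignedMeasure := by
    conv_lhs => rw [← posPart_sub_negPart u]
    rw [VectorMeasure.restrict_sub, JordanDecomposition.toSignedMeasure,
      ← Measure.toSignedMeasure_restrict_eq_restrict_toSignedMeasure _ _ hs,
      ← Measure.toSignedMeasure_restrict_eq_restrict_toSignedMeasure _ _ hs]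
  rw [posPart, SignedMeasure.toJordanDecomposition_eq hj]

theorem negPart_restrict (u : SignedMeasure X) {s : Set X} (hs : MeasurableSet s) :
    negPart (u.restrict s) = (negPart u).restrict s := by
  rw [← posPart_neg, ← posPart_neg, ← VectorMeasure.restrict_neg, posPart_restrict _ hs]

theorem apply_singleton [MeasurableSingletonClass X] (u : SignedMeasure X) (x : X) :
    u {x} = (posPart u).real {x} - (negPart u).real {x} :=
  u.apply_eq_posPart_real_sub_negPart_real (measurableSet_singleton x)

theorem posPart_singleton_eq_zero_or (u : SignedMeasure X) (x : X) :
    (posPart u).real {x} = 0 ∨ (negPart u).real {x} = 0 := by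
  obtain ⟨P, -, hneg, hpos⟩ := exists_measurableSet_negPart_eq_zero u
  by_cases hx : x ∈ P
  · exact Or.inr
      (measureReal_mono_null (singleton_subset_iff.2 hx) (by simp [measureReal_def, hneg]))
  · exact Or.inl
      (measureReal_mono_null (singleton_subset_iff.2 (mem_compl hx))
        (by simp [measureReal_def, hpos]))

variable [TopologicalSpace X] [OpensMeasurableSpace X]

theorem vectorMeasure_integrable (u : SignedMeasure X) (f : X →ᵇ ℝ) : u.Integrable f := by
  have : IsFiniteMeasure u.variation := by
    rw [← SignedMeasure.totalVariation_eq_variation, SignedMeasure.totalVariation]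
    infer_instance
  exact f.integrable _

theorem integral_eq_integral_posPart_sub (u : SignedMeasure X) (f : X →ᵇ ℝ) :
    ∫ᵛ x, f x ∂<•u = ∫ x, f x ∂(posPart u) - ∫ x, f x ∂(negPart u) := by
  conv_lhs => rw [← posPart_sub_negPart u]
  rw [VectorMeasure.integral_sub_vectorMeasure (vectorMeasure_integrable _ f)
    (vectorMeasure_integrable _ f), VectorMeasure.integral_toSignedMeasure,
    VectorMeasure.integral_toSignedMeasure]

end Jordan

/-! ### The mass of a positive measure -/

section PosMass

variable {X : Type*} [MeasurableSpace X]

/-- The `K`-mass of a positive measure `μ`, as a measure: an atom at `x` weighs `K (x, μ {x})`, and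
the diffuse part of `μ` is weighted by the slope of `K (x, ·)` at `0⁺`. -/
def posMass (K : X × ℝ → ℝ≥0∞) (μ : Measure X) : Measure X :=
  Measure.count.withDensity (fun x => K (x, μ.real {x}))
    + (μ.restrict {x | μ {x} = 0}).withDensity fun x => secantSlope (fun m => K (x, m)) 0

theorem posMass_apply (K : X × ℝ → ℝ≥0∞) (μ : Measure X) {A : Set X} (hA : MeasurableSet A) :
    posMass K μ A = ∫⁻ x in A, K (x, μ.real {x}) ∂Measure.count
      + ∫⁻ x in A, secantSlope (fun m => K (x, m)) 0 ∂(μ.restrict {x | μ {x} = 0}) := by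
  rw [posMass, Measure.add_apply, withDensity_apply _ hA, withDensity_apply _ hA]

variable [MeasurableSingletonClass X]

theorem countable_measure_singleton_ne_zero (μ : Measure X) [SFinite μ] :
    {x | μ {x} ≠ 0}.Countable := by
  have h := Measure.countable_meas_pos_of_disjoint_iUnion (μ := μ)
    (As := fun x : X => ({x} : Set X)) measurableSet_singleton
    fun x y hxy => by simpa [Function.onFun] using hxy
  simpa only [pos_iff_ne_zero] using h

theorem measurableSet_measure_singleton_eq_zero (μ : Measure X) [SFinite μ] :
    MeasurableSet {x | μ {x} = 0} := by
  simpa [compl_ofPred] using (countable_measure_singleton_ne_zero μ).measurableSet.compl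

theorem setLIntegral_eq_count_add (μ : Measure X) [SFinite μ] (f : X → ℝ≥0∞) {A : Set X}
    (hA : MeasurableSet A) :
    ∫⁻ x in A, f x ∂μ = ∫⁻ x in A, f x * μ {x} ∂Measure.count
      + ∫⁻ x in A, f x ∂(μ.restrict {x | μ {x} = 0}) := by
  have hcount : (A ∩ {x | μ {x} = 0}ᶜ).Countable :=
    (countable_measure_singleton_ne_zero μ).mono inter_subset_right
  rw [← lintegral_inter_add_sdiff f A (measurableSet_measure_singleton_eq_zero μ), add_comm,
    Measure.restrict_restrict hA]
  congr 1
  rw [sdiff_eq, lintegral_countable f hcount, ← lintegral_indicator hA, lintegral_count,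
    tsum_subtype (A ∩ {x | μ {x} = 0}ᶜ) fun x => f x * μ {x}]
  refine tsum_congr fun x => ?_
  by_cases hx : x ∈ A <;> by_cases h0 : μ {x} = 0 <;> simp [hx, h0]

theorem le_posMass_of_mem {K : X × ℝ → ℝ≥0∞} (μ : Measure X) {A : Set X} {x : X}
    (hx : x ∈ A) : K (x, μ.real {x}) ≤ posMass K μ A := by
  refine le_trans ?_ (measure_mono (singleton_subset_iff.2 hx))
  rw [posMass_apply K μ (measurableSet_singleton x)]
  simp

theorem mul_min_le_posMass {K : X × ℝ → ℝ≥0∞} (hK : ∀ x, RayConcave fun m => K (x, m))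
    (μ : Measure X) [IsFiniteMeasure μ] {A : Set X} (hA : MeasurableSet A) {t : ℝ} (ht : 0 < t)
    {c : ℝ≥0∞} (hc : ∀ x ∈ A, c ≤ K (x, t) / ENNReal.ofReal t) :
    c * min (μ A) (ENNReal.ofReal t) ≤ posMass K μ A := by
  by_cases hbig : ∃ x ∈ A, t ≤ μ.real {x}
  · obtain ⟨x, hxA, hx⟩ := hbig
    calc c * min (μ A) (ENNReal.ofReal t) ≤ c * ENNReal.ofReal t := by
          gcongr; exact min_le_right _ _
      _ ≤ K (x, t) := (hK x).mul_ofReal_le ht.le le_rfl (hc x hxA)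
      _ ≤ K (x, μ.real {x}) := (hK x).monotoneOn ht.le (ht.le.trans hx) hx
      _ ≤ posMass K μ A := le_posMass_of_mem μ hxA
  · push Not at hbig
    calc c * min (μ A) (ENNReal.ofReal t) ≤ c * μ A := by gcongr; exact min_le_left _ _
      _ = ∫⁻ _ in A, c ∂μ := (setLIntegral_const A c).symm
      _ = _ := setLIntegral_eq_count_add μ _ hA
      _ ≤ ∫⁻ x in A, K (x, μ.real {x}) ∂Measure.count
          + ∫⁻ x in A, secantSlope (fun m => K (x, m)) 0 ∂(μ.restrict {x | μ {x} = 0}) := by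
        refine add_le_add (setLIntegral_mono' hA fun x hx => ?_)
          (setLIntegral_mono' hA fun x hx => ?_)
        · simpa using (hK x).mul_ofReal_le measureReal_nonneg (hbig x hx).le (hc x hx)
        · exact (hc x hx).trans (le_biSup (fun t => K (x, t) / ENNReal.ofReal t) ht)
      _ = posMass K μ A := (posMass_apply K μ hA).symm

theorem posMass_univ_le_lintegral {K : X × ℝ → ℝ≥0∞} (hK : ∀ x, RayConcave fun m => K (x, m))
    (hlsc : ∀ x, LowerSemicontinuous fun m => K (x, m)) (μ : Measure X) [IsFiniteMeasure μ] :
    posMass K μ univ ≤ ∫⁻ x, secantSlope (fun m => K (x, m)) (μ.real {x}) ∂μ := by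
  rw [posMass_apply K μ MeasurableSet.univ, ← setLIntegral_univ (secantSlope _ <| μ.real {·}),
    setLIntegral_eq_count_add μ _ MeasurableSet.univ]
  refine add_le_add (lintegral_mono fun x => ?_) ?_
  · simpa using (hK x).le_secantSlope_mul (hlsc x) (m := μ.real {x}) measureReal_nonneg
  · rw [Measure.restrict_univ]
    refine setLIntegral_mono' (measurableSet_measure_singleton_eq_zero μ) fun x hx => ?_
    simp [measureReal_def, mem_ofPred_eq ▸ hx]

end PosMass

/-! ### The mass of a signed measure -/

/-- The reflection `(x, m) ↦ K (x, -m)`, which exchanges the roles of `u⁺` and `u⁻`. -/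
def reflect {X : Type*} (K : X × ℝ → ℝ≥0∞) : X × ℝ → ℝ≥0∞ := fun p => K (p.1, -p.2)

theorem lowerSemicontinuous_reflect {X : Type*} [TopologicalSpace X] {K : X × ℝ → ℝ≥0∞}
    (hlsc : LowerSemicontinuous K) : LowerSemicontinuous (reflect K) :=
  hlsc.comp (by fun_prop : Continuous fun p : X × ℝ => (p.1, -p.2))

section MassH

variable {N : ℕ}

theorem diffusePart_neg (u : SignedMeasure (E N)) : diffusePart (-u) = -diffusePart u := by
  have hatoms : atoms (-u) = atoms u := by ext x; simp [atoms]
  rw [diffusePart, hatoms, VectorMeasure.restrict_neg, diffusePart]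

theorem posPart_diffusePart (u : SignedMeasure (E N)) :
    posPart (diffusePart u) = (posPart u).restrict {x | posPart u {x} = 0} := by
  rw [diffusePart, posPart_restrict u (measurableSet_atoms u).compl]
  refine Measure.restrict_congr_set (ae_eq_set.2 ⟨?_, ?_⟩)
  · refine measure_mono_null (fun x hx => hx.2 ?_) measure_empty
    have hpos : (posPart u).real {x} = 0 := by
      have hux : u {x} = 0 := by simpa [atoms] using hx.1
      rw [apply_singleton] at hux
      rcases posPart_singleton_eq_zero_or u x with h | h <;> linarith
    simpa [measureReal_def, ENNReal.toReal_eq_zero_iff] using hpos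
  · refine (measure_null_iff_singleton ((countable_atoms u).mono fun x hx => ?_)).2 fun x hx => hx.1
    simpa using hx.2

theorem massH_eq_posMass_add {K : E N × ℝ → ℝ≥0∞} (hK : ∀ x, RayConcave fun m => K (x, m))
    (u : SignedMeasure (E N)) :
    massH K u = posMass K (posPart u) univ + posMass (reflect K) (posPart (-u)) univ := by
  have hatom : ∫⁻ x, K (x, u {x}) ∂Measure.count
      = ∫⁻ x, K (x, (posPart u).real {x}) ∂Measure.count
        + ∫⁻ x, reflect K (x, (posPart (-u)).real {x}) ∂Measure.count := by
    simp only [lintegral_count, ← ENNReal.tsum_add, reflect, posPart_neg, apply_singleton]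
    refine tsum_congr fun x => ?_
    rcases posPart_singleton_eq_zero_or u x with h | h <;> simp [h, (hK x).map_zero]
  have hneg : negPart (diffusePart u) = (posPart (-u)).restrict {x | posPart (-u) {x} = 0} := by
    rw [← posPart_neg, ← diffusePart_neg, posPart_diffusePart]
  simp only [posMass_apply _ _ MeasurableSet.univ, Measure.restrict_univ, massH, hatom,
    rightSlope_eq_secantSlope (hK _), leftSlope_eq_secantSlope (hK _)]
  rw [← posPart, posPart_diffusePart, ← negPart, hneg]
  simp only [reflect]
  abel

theorem diffusePart_sum_dirac (s : Finset (E N)) (m : E N → ℝ) :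
    diffusePart (∑ x ∈ s, VectorMeasure.dirac x (m x)) = 0 := by
  ext B hB
  rw [diffusePart, VectorMeasure.restrict_apply _ (measurableSet_atoms _).compl hB,
    _root_.sum_apply]
  refine Finset.sum_eq_zero fun x hx => ?_
  by_cases hxB : x ∈ B ∩ (atoms (∑ x ∈ s, VectorMeasure.dirac x (m x)))ᶜ
  · have hmx : m x = 0 := by
      simpa only [atoms, mem_compl_iff, mem_ofPred_eq, not_not, sum_dirac_singleton,
        indicator_of_mem (Finset.mem_coe.2 hx)] using hxB.2
    simp [hmx]
  · exact VectorMeasure.dirac_apply_of_notMem hxB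

theorem massH_sum_dirac {K : E N × ℝ → ℝ≥0∞} (h0 : ∀ x, K (x, 0) = 0) (s : Finset (E N))
    (m : E N → ℝ) : massH K (∑ x ∈ s, VectorMeasure.dirac x (m x)) = ∑ x ∈ s, K (x, m x) := by
  simp only [massH, diffusePart_sum_dirac, SignedMeasure.toJordanDecomposition_zero,
    JordanDecomposition.zero_posPart, JordanDecomposition.zero_negPart, lintegral_zero_measure,
    add_zero, lintegral_count, sum_dirac_singleton]
  rw [tsum_eq_sum (s := s) fun x hx => by simp [hx, h0]]
  exact Finset.sum_congr rfl fun x hx => by simp [hx]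

theorem massH_le_massAtom {K H : E N × ℝ → ℝ≥0∞} (h0 : ∀ x, K (x, 0) = 0) (hKH : K ≤ H) :
    massH K ≤ massAtom H := by
  refine fun u => le_iInf fun s => le_iInf fun m => le_iInf fun hu => ?_
  rw [hu, massH_sum_dirac h0]
  exact Finset.sum_le_sum fun x _ => hKH _

end MassH

/-! ### Localization -/

theorem measurable_finset_sup {α ι : Type*} [MeasurableSpace α] {f : ι → α → ℝ≥0∞}
    (hf : ∀ i, Measurable (f i)) (s : Finset ι) : Measurable (s.sup f) :=
  Finset.sup_induction measurable_const (fun _ ha _ hb => ha.sup hb) fun i _ => hf i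

theorem exists_pairwiseDisjoint_sup_eq_sum_indicator {α ι : Type*} [MeasurableSpace α]
    {f : ι → α → ℝ≥0∞} (hf : ∀ i, Measurable (f i)) (s : Finset ι) :
    ∃ B : ι → Set α, (∀ i, MeasurableSet (B i)) ∧ (s : Set ι).PairwiseDisjoint B ∧
      s.sup f = ∑ i ∈ s, (B i).indicator (f i) := by
  classical
  induction s using Finset.induction_on with
  | empty => exact ⟨fun _ => ∅, fun _ => MeasurableSet.empty, by simp, rfl⟩
  | insert j s hj ih =>
    obtain ⟨B, hBm, hBd, hB⟩ := ih
    have hne : ∀ {i}, i ∈ s → i ≠ j := fun hi => ne_of_mem_of_not_mem hi hj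
    have hg : Measurable (s.sup f) := measurable_finset_sup hf s
    -- `f j` is the largest of the functions exactly where it exceeds the previous maximum.
    let D : Set α := {x | s.sup f x < f j x}
    have hD : MeasurableSet D := measurableSet_lt hg (hf j)
    refine ⟨fun i => if i = j then D else B i \ D, fun i => ?_, ?_, funext fun x => ?_⟩
    · dsimp only
      split_ifs
      exacts [hD, (hBm i).diff hD]
    · rw [Finset.coe_insert, pairwiseDisjoint_insert_of_notMem (by simpa using hj)]
      refine ⟨fun i hi k hk hik => ?_, fun i hi => ?_⟩
      · simpa only [Function.onFun, if_neg (hne hi), if_neg (hne hk)] using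
          (hBd hi hk hik).mono sdiff_subset sdiff_subset
      · simpa only [if_neg (hne hi), if_true] using disjoint_sdiff_right
    · have hsum : ∑ i ∈ s, (if i = j then D else B i \ D).indicator (f i)
          = Dᶜ.indicator (s.sup f) := by
        rw [hB, Finset.indicator_sum]
        exact Finset.sum_congr rfl fun i hi => by
          rw [if_neg (hne hi), indicator_indicator, inter_comm, sdiff_eq]
      simp only [Finset.sum_insert hj, Finset.sup_insert, if_true, hsum, Pi.add_apply,
        Pi.sup_apply]
      by_cases hx : x ∈ D
      · rw [indicator_of_mem hx, indicator_of_notMem (not_not.2 hx), add_zero,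
          sup_eq_left.2 (le_of_lt hx)]
      · rw [indicator_of_notMem hx, indicator_of_mem hx, zero_add, sup_eq_right.2 (not_lt.1 hx)]

theorem exists_isOpen_pairwiseDisjoint_between {X ι : Type*} [TopologicalSpace X] [NormalSpace X]
    {s : Finset ι} {F A : ι → Set X} (hF : ∀ i, IsClosed (F i)) (hA : ∀ i, IsOpen (A i))
    (hFA : ∀ i, F i ⊆ A i) (hd : (s : Set ι).PairwiseDisjoint F) :
    ∃ U : ι → Set X, (∀ i, IsOpen (U i)) ∧ (∀ i, F i ⊆ U i) ∧ (∀ i, U i ⊆ A i) ∧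
      (s : Set ι).PairwiseDisjoint U := by
  have hnhds : (s : Set ι).PairwiseDisjoint fun i => 𝓝ˢ (F i) := fun i hi j hj hij =>
    separatedNhds_iff_disjoint.1 (normal_separation (hF i) (hF j) (hd hi hj hij))
  obtain ⟨V, hV, hVd⟩ :=
    hnhds.exists_mem_filter_basis s.finite_toSet fun i => hasBasis_nhdsSet (F i)
  exact ⟨fun i => V i ∩ A i, fun i => (hV i).1.inter (hA i), fun i => subset_inter (hV i).2 (hFA i),
    fun i => inter_subset_right, hVd.mono fun i => inter_subset_left⟩

theorem finsetSum_mul_measure_eq_iSup_isClosed {X ι : Type*} [TopologicalSpace X]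
    [MeasurableSpace X] (μ : Measure X) [IsFiniteMeasure μ] [μ.WeaklyRegular] (c : ι → ℝ≥0∞)
    {B : ι → Set X} (hB : ∀ i, MeasurableSet (B i)) (s : Finset ι) :
    ∑ i ∈ s, c i * μ (B i)
      = ⨆ F : ∀ i, {F : Set X // F ⊆ B i ∧ IsClosed F}, ∑ i ∈ s, c i * μ (F i) := by
  have hne : ∀ i, Nonempty {F : Set X // F ⊆ B i ∧ IsClosed F} := fun i =>
    ⟨⟨∅, empty_subset _, isClosed_empty⟩⟩
  have hsup : ∀ i, c i * μ (B i)
      = ⨆ F : ∀ i, {F : Set X // F ⊆ B i ∧ IsClosed F}, c i * μ (F i) := by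
    intro i
    rw [(hB i).measure_eq_iSup_isClosed_of_ne_top (measure_ne_top μ _), ← ENNReal.mul_iSup,
      (Function.surjective_eval (β := fun i => {F : Set X // F ⊆ B i ∧ IsClosed F}) i).iSup_comp
        (g := fun F => μ F)]
    simp only [iSup_subtype, iSup_and]
  rw [Finset.sum_congr rfl fun i _ => hsup i]
  refine ENNReal.finsetSum_iSup fun F G => ⟨fun i => ⟨F i ∪ G i, union_subset (F i).2.1 (G i).2.1,
    (F i).2.2.union (G i).2.2⟩, fun i => ⟨?_, ?_⟩⟩
  · gcongr; exact subset_union_left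
  · gcongr; exact subset_union_right

section Superadditive

variable {X ι : Type*} [TopologicalSpace X] {Φ : Set X → ℝ≥0∞}

theorem sum_le_of_superadditive
    (hadd : ∀ U V, IsOpen U → IsOpen V → Disjoint U V → Φ U + Φ V ≤ Φ (U ∪ V))
    (s : Finset ι) {U : ι → Set X} (hU : ∀ i, IsOpen (U i))
    (hd : (s : Set ι).PairwiseDisjoint U) : ∑ i ∈ s, Φ (U i) ≤ Φ (⋃ i ∈ s, U i) := by
  classical
  induction s using Finset.induction_on with
  | empty => simp
  | insert j s hj ih =>
    rw [Finset.coe_insert, pairwiseDisjoint_insert_of_notMem (by simpa using hj)] at hd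
    rw [Finset.sum_insert hj, Finset.set_biUnion_insert]
    exact (add_le_add_right (ih hd.1) _).trans
      (hadd _ _ (hU j) (isOpen_biUnion fun i _ => hU i) (disjoint_iUnion₂_right.2 hd.2))

variable [NormalSpace X] [MeasurableSpace X] (μ : Measure X) [IsFiniteMeasure μ]
  [μ.WeaklyRegular] {A : ι → Set X} {c : ι → ℝ≥0∞}

theorem sum_mul_measure_le_of_superadditive (hmono : Monotone Φ)
    (hadd : ∀ U V, IsOpen U → IsOpen V → Disjoint U V → Φ U + Φ V ≤ Φ (U ∪ V))
    (hA : ∀ i, IsOpen (A i)) (hc : ∀ i U, IsOpen U → U ⊆ A i → c i * μ U ≤ Φ U)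
    (s : Finset ι) {B : ι → Set X} (hB : ∀ i, MeasurableSet (B i)) (hBA : ∀ i, B i ⊆ A i)
    (hd : (s : Set ι).PairwiseDisjoint B) : ∑ i ∈ s, c i * μ (B i) ≤ Φ univ := by
  rw [finsetSum_mul_measure_eq_iSup_isClosed μ c hB]
  refine iSup_le fun F => ?_
  obtain ⟨U, hU, hFU, hUA, hUd⟩ := exists_isOpen_pairwiseDisjoint_between (fun i => (F i).2.2) hA
    (fun i => (F i).2.1.trans (hBA i)) (hd.mono fun i => (F i).2.1)
  calc ∑ i ∈ s, c i * μ (F i) ≤ ∑ i ∈ s, c i * μ (U i) :=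
        Finset.sum_le_sum fun i _ => by gcongr; exact hFU i
    _ ≤ ∑ i ∈ s, Φ (U i) := Finset.sum_le_sum fun i _ => hc i _ (hU i) (hUA i)
    _ ≤ Φ (⋃ i ∈ s, U i) := sum_le_of_superadditive hadd s hU hUd
    _ ≤ Φ univ := hmono (subset_univ _)

theorem lintegral_iSup_indicator_le_of_superadditive [BorelSpace X] [Countable ι]
    (hmono : Monotone Φ)
    (hadd : ∀ U V, IsOpen U → IsOpen V → Disjoint U V → Φ U + Φ V ≤ Φ (U ∪ V))
    (hA : ∀ i, IsOpen (A i)) (hc : ∀ i U, IsOpen U → U ⊆ A i → c i * μ U ≤ Φ U) :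
    ∫⁻ x, ⨆ i, (A i).indicator (fun _ => c i) x ∂μ ≤ Φ univ := by
  let f : ι → X → ℝ≥0∞ := fun i => (A i).indicator fun _ => c i
  have hf : ∀ i, Measurable (f i) := fun i => measurable_const.indicator (hA i).measurableSet
  have hsup : ∀ x, ⨆ i, f i x = ⨆ s : Finset ι, s.sup f x := fun x => by
    simp only [Finset.sup_apply, Finset.sup_eq_iSup, ← iSup_eq_iSup_finset]
  rw [lintegral_congr hsup, lintegral_iSup_directed
    (fun s => (measurable_finset_sup hf s).aemeasurable)
    (directed_of_isDirected_le fun s t h => Finset.sup_mono h)]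
  refine iSup_le fun s => ?_
  obtain ⟨B, hB, hBd, hsum⟩ := exists_pairwiseDisjoint_sup_eq_sum_indicator hf s
  calc ∫⁻ x, s.sup f x ∂μ = ∑ i ∈ s, ∫⁻ x, (B i).indicator (f i) x ∂μ := by
        simp only [hsum, Finset.sum_apply]
        exact lintegral_finsetSum s fun i _ => (hf i).indicator (hB i)
    _ = ∑ i ∈ s, c i * μ (B i ∩ A i) := Finset.sum_congr rfl fun i _ => by
        rw [indicator_indicator,
          lintegral_indicator_const ((hB i).inter (hA i).measurableSet)]
    _ ≤ Φ univ := sum_mul_measure_le_of_superadditive μ hmono hadd hA hc s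
        (fun i => (hB i).inter (hA i).measurableSet) (fun i => inter_subset_right)
        (hBd.mono fun i => inter_subset_left)

end Superadditive

/-! ### Lower semicontinuity -/

theorem liminf_add_liminf_le {α : Type*} (l : Filter α) (f g : α → ℝ≥0∞) :
    liminf f l + liminf g l ≤ liminf (fun x => f x + g x) l := by
  rcases eq_or_ne (liminf f l) 0 with hf | hf
  · rw [hf, zero_add]
    exact liminf_le_liminf (Eventually.of_forall fun x => le_add_self)
  rcases eq_or_ne (liminf g l) 0 with hg | hg
  · rw [hg, add_zero]
    exact liminf_le_liminf (Eventually.of_forall fun x => le_self_add)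
  refine le_of_forall_lt_imp_le_of_dense fun d hd => ?_
  obtain ⟨a, ha, b, hb, hab⟩ := ENNReal.exists_lt_add_of_lt_add hd hf hg
  refine hab.le.trans (le_liminf_of_le (by isBoundedDefault) ?_)
  filter_upwards [eventually_lt_of_lt_liminf ha, eventually_lt_of_lt_liminf hb] with x hx hx'
  exact add_le_add hx.le hx'.le

section TestFunctions

variable {X : Type*} [TopologicalSpace X] [MeasurableSpace X] [OpensMeasurableSpace X]

theorem ofReal_integral_le_posPart (v : SignedMeasure X) (f : X →ᵇ ℝ) {U : Set X}
    (hU : MeasurableSet U) (hf : ∀ x, f x ∈ Icc (0 : ℝ) 1) (hfU : EqOn f 0 Uᶜ) :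
    ENNReal.ofReal (∫ᵛ x, f x ∂<•v) ≤ posPart v U := by
  refine ENNReal.ofReal_le_of_le_toReal ?_
  rw [integral_eq_integral_posPart_sub]
  have hneg : 0 ≤ ∫ x, f x ∂(negPart v) := integral_nonneg fun x => (hf x).1
  have hpos : ∫ x, f x ∂(posPart v) ≤ ∫ x, U.indicator 1 x ∂(posPart v) := by
    refine integral_mono (f.integrable _) ((integrable_const 1).indicator hU) fun x => ?_
    by_cases hx : x ∈ U
    · simpa [hx] using (hf x).2
    · simpa [hx] using (hfU hx).le
  rw [integral_indicator_one hU] at hpos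
  exact (sub_le_self _ hneg).trans hpos

theorem posPart_le_ofReal_integral_add (u : SignedMeasure X) (f : X →ᵇ ℝ) {C U : Set X}
    (hC : MeasurableSet C) (hU : MeasurableSet U) (hf : ∀ x, f x ∈ Icc (0 : ℝ) 1)
    (hfU : EqOn f 0 Uᶜ) (hfC : EqOn f 1 C) :
    posPart u C ≤ ENNReal.ofReal (∫ᵛ x, f x ∂<•u) + negPart u U := by
  have hpos : ∫ x, C.indicator 1 x ∂(posPart u) ≤ ∫ x, f x ∂(posPart u) := by
    refine integral_mono ((integrable_const 1).indicator hC) (f.integrable _) fun x => ?_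
    by_cases hx : x ∈ C
    · simpa [hx] using (hfC hx).ge
    · simpa [hx] using (hf x).1
  have hneg : ∫ x, f x ∂(negPart u) ≤ ∫ x, U.indicator 1 x ∂(negPart u) := by
    refine integral_mono (f.integrable _) ((integrable_const 1).indicator hU) fun x => ?_
    by_cases hx : x ∈ U
    · simpa [hx] using (hf x).2
    · simpa [hx] using (hfU hx).le
  rw [integral_indicator_one hC] at hpos
  rw [integral_indicator_one hU] at hneg
  calc posPart u C = ENNReal.ofReal ((posPart u).real C) := by rw [ofReal_measureReal]
    _ ≤ ENNReal.ofReal (∫ᵛ x, f x ∂<•u + (negPart u).real U) := by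
        refine ENNReal.ofReal_le_ofReal ?_
        rw [integral_eq_integral_posPart_sub]
        linarith
    _ ≤ _ := ENNReal.ofReal_add_le.trans (by rw [ofReal_measureReal])

end TestFunctions

section NarrowLsc

variable {X : Type*} [TopologicalSpace X] [TopologicalSpace.PseudoMetrizableSpace X]
  [MeasurableSpace X] [BorelSpace X]

theorem posPart_eq_iSup_ofReal_integral (u : SignedMeasure X) {U : Set X} (hU : IsOpen U) :
    posPart u U = ⨆ (f : X →ᵇ ℝ) (_ : ∀ x, f x ∈ Icc (0 : ℝ) 1) (_ : EqOn f 0 Uᶜ),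
      ENNReal.ofReal (∫ᵛ x, f x ∂<•u) := by
  refine le_antisymm ?_ (iSup_le fun f => iSup₂_le fun hf hfU =>
    ofReal_integral_le_posPart u f hU.measurableSet hf hfU)
  obtain ⟨P, hP, hPneg, hPpos⟩ := exists_measurableSet_negPart_eq_zero u
  rw [← measure_inter_add_sdiff U hP, measure_mono_null (sdiff_subset_compl U P) hPpos, add_zero,
    (hU.measurableSet.inter hP).measure_eq_iSup_isClosed_of_ne_top (measure_ne_top _ _)]
  refine iSup₂_le fun C hCUP => iSup_le fun hC => ENNReal.le_of_forall_pos_le_add fun ε hε _ => ?_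
  obtain ⟨O, hCO, hO, hOε⟩ := C.exists_isOpen_lt_of_lt (μ := negPart u) ε <| by
    rw [measure_mono_null (hCUP.trans inter_subset_right) hPneg]
    exact_mod_cast hε
  obtain ⟨f, hf0, hf1, hf⟩ := exists_bounded_zero_one_of_closed (hU.inter hO).isClosed_compl hC
    (disjoint_compl_left_iff_subset.2 (subset_inter (hCUP.trans inter_subset_left) hCO))
  calc posPart u C ≤ ENNReal.ofReal (∫ᵛ x, f x ∂<•u) + negPart u (U ∩ O) :=
        posPart_le_ofReal_integral_add u f hC.measurableSet (hU.inter hO).measurableSet hf hf0 hf1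
    _ ≤ _ := by
        gcongr
        · exact le_iSup_of_le f (le_iSup₂_of_le hf
            (hf0.mono (compl_subset_compl.2 inter_subset_left)) le_rfl)
        · exact (measure_mono inter_subset_right).trans hOε.le

theorem posPart_le_liminf {v : ℕ → SignedMeasure X} {u : SignedMeasure X}
    (hv : ∀ f : X →ᵇ ℝ, Tendsto (fun n => ∫ᵛ x, f x ∂<•(v n)) atTop (𝓝 (∫ᵛ x, f x ∂<•u)))
    {U : Set X} (hU : IsOpen U) :
    posPart u U ≤ liminf (fun n => posPart (v n) U) atTop := by
  rw [posPart_eq_iSup_ofReal_integral u hU]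
  refine iSup_le fun f => iSup₂_le fun hf hfU => ?_
  rw [← (ENNReal.tendsto_ofReal (hv f)).liminf_eq]
  exact liminf_le_liminf (Eventually.of_forall fun n =>
    ofReal_integral_le_posPart (v n) f hU.measurableSet hf hfU)

end NarrowLsc

section SlopeOn

variable {X : Type*} [MeasurableSpace X]

/-- The largest constant `c` such that, for some mass `t > μ A`, the slope `K (y, t) / t` is at
least `c` for all `y ∈ A`. It bounds below the cost per unit mass of the measures on `A` close
to `μ`. -/
def slopeOn (K : X × ℝ → ℝ≥0∞) (μ : Measure X) (A : Set X) : ℝ≥0∞ :=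
  ⨆ (t : ℝ) (_ : μ A < ENNReal.ofReal t), ⨅ y ∈ A, K (y, t) / ENNReal.ofReal t

theorem slopeOn_mul_le_liminf_posMass [MeasurableSingletonClass X] {K : X × ℝ → ℝ≥0∞}
    (hK : ∀ x, RayConcave fun m => K (x, m)) {μ : Measure X} {ν : ℕ → Measure X}
    [∀ n, IsFiniteMeasure (ν n)] {A U : Set X} (hUA : U ⊆ A) (hU : MeasurableSet U)
    (hν : μ U ≤ liminf (fun n => ν n U) atTop) :
    slopeOn K μ A * μ U ≤ liminf (fun n => posMass K (ν n) U) atTop := by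
  simp only [slopeOn, ENNReal.iSup_mul]
  refine iSup₂_le fun t ht => ENNReal.mul_le_of_forall_lt fun c hc b hb => ?_
  refine le_liminf_of_le (by isBoundedDefault) ?_
  filter_upwards [eventually_lt_of_lt_liminf (hb.trans_le hν)] with n hn
  have hbt : b ≤ ENNReal.ofReal t := hb.le.trans ((measure_mono hUA).trans ht.le)
  calc c * b ≤ c * min (ν n U) (ENNReal.ofReal t) := by gcongr; exact le_min hn.le hbt
    _ ≤ posMass K (ν n) U := mul_min_le_posMass hK _ hU (by simpa using zero_le.trans_lt ht)
        fun x hx => hc.le.trans (biInf_le _ (hUA hx))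

variable [TopologicalSpace X] [SecondCountableTopology X]

theorem secantSlope_le_iSup_slopeOn {K : X × ℝ → ℝ≥0∞} (hlsc : LowerSemicontinuous K)
    (μ : Measure X) [IsFiniteMeasure μ] [μ.OuterRegular] (x : X) :
    secantSlope (fun m => K (x, m)) (μ.real {x}) ≤
      ⨆ A : TopologicalSpace.countableBasis X,
        (A : Set X).indicator (fun _ => slopeOn K μ A) x := by
  refine iSup₂_le fun t ht => le_of_forall_lt_imp_le_of_dense fun d hd => ?_
  have ht0 : 0 < t := measureReal_nonneg.trans_lt ht
  obtain ⟨U, hxU, hU, hUt⟩ := Set.exists_isOpen_lt_of_lt {x} (ENNReal.ofReal t) <| by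
    rwa [ENNReal.lt_ofReal_iff_toReal_lt (measure_ne_top μ _)]
  have hev : ∀ᶠ y in 𝓝 x, d * ENNReal.ofReal t < K (y, t) :=
    (hlsc.comp (by fun_prop : Continuous fun y : X => (y, t))) x _
      ((ENNReal.lt_div_iff_mul_lt (by simp [ht0]) (by simp)).1 hd)
  obtain ⟨A, hA, hxA, hAU⟩ := (TopologicalSpace.isBasis_countableBasis X).mem_nhds_iff.1
    (inter_mem (hU.mem_nhds (singleton_subset_iff.1 hxU)) hev)
  refine le_iSup_of_le ⟨A, hA⟩ ?_
  rw [indicator_of_mem hxA]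
  refine le_iSup₂_of_le t ((measure_mono fun y hy => (hAU hy).1).trans_lt hUt) ?_
  refine le_iInf₂ fun y hy => ?_
  rw [ENNReal.le_div_iff_mul_le (by simp [ht0]) (by simp)]
  exact (hAU hy).2.le

end SlopeOn

theorem posMass_le_liminf {X : Type*} [TopologicalSpace X] [TopologicalSpace.MetrizableSpace X]
    [SecondCountableTopology X] [MeasurableSpace X] [BorelSpace X]
    {K : X × ℝ → ℝ≥0∞} (hK : ∀ x, RayConcave fun m => K (x, m)) (hlsc : LowerSemicontinuous K)
    {v : ℕ → SignedMeasure X} {u : SignedMeasure X}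
    (hv : ∀ f : X →ᵇ ℝ, Tendsto (fun n => ∫ᵛ x, f x ∂<•(v n)) atTop (𝓝 (∫ᵛ x, f x ∂<•u))) :
    posMass K (posPart u) univ ≤ liminf (fun n => posMass K (posPart (v n)) univ) atTop := by
  have hopen : ∀ A : TopologicalSpace.countableBasis X, IsOpen (A : Set X) := fun A =>
    TopologicalSpace.isOpen_of_mem_countableBasis A.2
  have : Countable (TopologicalSpace.countableBasis X) :=
    (TopologicalSpace.countable_countableBasis X).to_subtype
  let Φ : Set X → ℝ≥0∞ := fun U => liminf (fun n => posMass K (posPart (v n)) U) atTop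
  have hmono : Monotone Φ := fun U V hUV =>
    liminf_le_liminf (Eventually.of_forall fun n => measure_mono hUV)
  have hadd : ∀ U V, IsOpen U → IsOpen V → Disjoint U V → Φ U + Φ V ≤ Φ (U ∪ V) :=
    fun U V _ hV hUV => by
      simpa only [Φ, measure_union hUV hV.measurableSet] using liminf_add_liminf_le atTop _ _
  have hslope : ∀ (A : TopologicalSpace.countableBasis X) (U : Set X), IsOpen U → U ⊆ A →
      slopeOn K (posPart u) A * posPart u U ≤ Φ U := fun A U hU hUA =>
    slopeOn_mul_le_liminf_posMass hK hUA hU.measurableSet (posPart_le_liminf hv hU)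
  calc posMass K (posPart u) univ
      ≤ ∫⁻ x, secantSlope (fun m => K (x, m)) ((posPart u).real {x}) ∂(posPart u) :=
        posMass_univ_le_lintegral hK
          (fun x => hlsc.comp (by fun_prop : Continuous fun m : ℝ => (x, m))) _
    _ ≤ ∫⁻ x, ⨆ A : TopologicalSpace.countableBasis X,
          (A : Set X).indicator (fun _ => slopeOn K (posPart u) A) x ∂(posPart u) :=
        lintegral_mono (secantSlope_le_iSup_slopeOn hlsc (posPart u))
    _ ≤ Φ univ :=
        lintegral_iSup_indicator_le_of_superadditive (posPart u) hmono hadd hopen hslope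

section SeqNarrowLsc

variable {N : ℕ}

theorem NarrowTendsto.neg {v : ℕ → SignedMeasure (E N)} {u : SignedMeasure (E N)}
    (hv : NarrowTendsto v u) : NarrowTendsto (fun n => -v n) (-u) := fun f => by
  simpa only [VectorMeasure.integral_neg_vectorMeasure] using (hv f).neg

theorem seqNarrowLsc_massH {K : E N × ℝ → ℝ≥0∞} (hK : ∀ x, RayConcave fun m => K (x, m))
    (hlsc : LowerSemicontinuous K) : SeqNarrowLsc (massH K) := by
  intro v u hv
  simp only [massH_eq_posMass_add hK]
  exact (add_le_add (posMass_le_liminf hK hlsc hv)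
    (posMass_le_liminf (fun x => (hK x).comp_neg) (lowerSemicontinuous_reflect hlsc) hv.neg)).trans
    (liminf_add_liminf_le _ _ _)

end SeqNarrowLsc

/-! ### Envelopes -/

section LscEnvelope

variable {N : ℕ}

theorem lscEnvelope_le (H : E N × ℝ → ℝ≥0∞) : lscEnvelope H ≤ H :=
  sSup_le fun _ hG => hG.1

theorem le_lscEnvelope {H G : E N × ℝ → ℝ≥0∞} (h : G ≤ H) (hG : LowerSemicontinuous G) :
    G ≤ lscEnvelope H :=
  le_sSup ⟨h, hG⟩

theorem lowerSemicontinuous_lscEnvelope (H : E N × ℝ → ℝ≥0∞) :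
    LowerSemicontinuous (lscEnvelope H) := by
  rw [lscEnvelope, sSup_eq_iSup']
  simpa only [← iSup_apply] using lowerSemicontinuous_iSup
    fun G : {G : E N × ℝ → ℝ≥0∞ | G ≤ H ∧ LowerSemicontinuous G} => G.2.2

theorem rayConcave_lscEnvelope {H : E N × ℝ → ℝ≥0∞} (hH : ∀ x, RayConcave fun m => H (x, m))
    (x : E N) : RayConcave fun m => lscEnvelope H (x, m) := by
  refine ⟨le_antisymm ((lscEnvelope_le H _).trans_eq (hH x).map_zero) zero_le, fun l m => ?_⟩
  rcases eq_or_ne l 0 with rfl | hl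
  · simp
  let G : E N × ℝ → ℝ≥0∞ := fun p => min 1 (l : ℝ≥0∞) * lscEnvelope H (p.1, p.2 / l)
  have hG : LowerSemicontinuous G :=
    (ENNReal.continuous_const_mul (by simp)).comp_lowerSemicontinuous
      ((lowerSemicontinuous_lscEnvelope H).comp
        (by fun_prop : Continuous fun p : E N × ℝ => (p.1, p.2 / (l : ℝ))))
      fun _ _ h => mul_le_mul_right h _
  have hGH : G ≤ H := fun p =>
    calc G p ≤ min 1 (l : ℝ≥0∞) * H (p.1, p.2 / l) := by
          dsimp only [G]; gcongr; exact lscEnvelope_le H _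
      _ ≤ H (p.1, l * (p.2 / l)) := (hH p.1).min_one_mul_le _ _
      _ = H p := by rw [mul_div_cancel₀ _ (by exact_mod_cast hl)]
  simpa [G, hl] using le_lscEnvelope hGH hG (x, l * m)

end LscEnvelope

section SeqNarrowLscEnvelope

variable {N : ℕ} {Φ : SignedMeasure (E N) → ℝ≥0∞}

theorem seqNarrowLscEnvelope_le (Φ : SignedMeasure (E N) → ℝ≥0∞) : seqNarrowLscEnvelope Φ ≤ Φ :=
  sSup_le fun _ hF => hF.1

theorem le_seqNarrowLscEnvelope {F : SignedMeasure (E N) → ℝ≥0∞} (h : F ≤ Φ)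
    (hF : SeqNarrowLsc F) : F ≤ seqNarrowLscEnvelope Φ :=
  le_sSup ⟨h, hF⟩

theorem seqNarrowLsc_seqNarrowLscEnvelope (Φ : SignedMeasure (E N) → ℝ≥0∞) :
    SeqNarrowLsc (seqNarrowLscEnvelope Φ) := by
  intro v u hv
  conv_lhs => rw [seqNarrowLscEnvelope, sSup_apply]
  exact iSup_le fun F => (F.2.2 v u hv).trans
    (liminf_le_liminf (Eventually.of_forall fun n => le_seqNarrowLscEnvelope F.2.1 F.2.2 (v n)))

theorem NarrowTendsto.add {v w : ℕ → SignedMeasure (E N)} {u z : SignedMeasure (E N)}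
    (hv : NarrowTendsto v u) (hw : NarrowTendsto w z) :
    NarrowTendsto (fun n => v n + w n) (u + z) := fun f => by
  simpa only [VectorMeasure.integral_add_vectorMeasure (vectorMeasure_integrable _ f)
    (vectorMeasure_integrable _ f)] using (hv f).add (hw f)

theorem NarrowTendsto.const (u : SignedMeasure (E N)) : NarrowTendsto (fun _ => u) u :=
  fun _ => tendsto_const_nhds

theorem SeqNarrowLsc.add_right_sub {F : SignedMeasure (E N) → ℝ≥0∞} (hF : SeqNarrowLsc F)
    (w : SignedMeasure (E N)) (c : ℝ≥0∞) : SeqNarrowLsc fun u => F (u + w) - c := by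
  intro v u hv
  rw [ENNReal.liminf_sub_const]
  exact tsub_le_tsub_right (hF _ _ (hv.add (.const w))) c

/-- Freezing first `v`, then `u`, turns subadditivity of `Φ` into a statement about the lower
semicontinuous minorants `F (· + v) - Φ v` and `F (· + u) - F u`, `F` being the envelope. -/
theorem seqNarrowLscEnvelope_add_le (hΦ : ∀ u v, Φ (u + v) ≤ Φ u + Φ v)
    (u v : SignedMeasure (E N)) :
    seqNarrowLscEnvelope Φ (u + v) ≤ seqNarrowLscEnvelope Φ u + seqNarrowLscEnvelope Φ v := by
  have hlsc := seqNarrowLsc_seqNarrowLscEnvelope Φ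
  have hmixed : ∀ u v, seqNarrowLscEnvelope Φ (u + v) ≤ seqNarrowLscEnvelope Φ u + Φ v :=
    fun u v => tsub_le_iff_right.1 <| le_seqNarrowLscEnvelope
      (fun u => tsub_le_iff_right.2 ((seqNarrowLscEnvelope_le Φ _).trans (hΦ u v)))
      (hlsc.add_right_sub v (Φ v)) u
  rw [add_comm u v, add_comm (seqNarrowLscEnvelope Φ u), ← tsub_le_iff_right]
  refine le_seqNarrowLscEnvelope (fun v => tsub_le_iff_left.2 ?_)
    (hlsc.add_right_sub u (seqNarrowLscEnvelope Φ u)) v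
  rw [add_comm v u]
  exact hmixed u v

end SeqNarrowLscEnvelope

section Dirac

theorem dirac_add {X M : Type*} [MeasurableSpace X] [AddCommMonoid M] [TopologicalSpace M]
    [ContinuousAdd M] (x : X) (a b : M) :
    VectorMeasure.dirac x (a + b) = VectorMeasure.dirac x a + VectorMeasure.dirac x b := by
  ext s hs
  by_cases hx : x ∈ s <;> simp [hx, hs]

theorem dirac_neg {X M : Type*} [MeasurableSpace X] [AddCommGroup M] [TopologicalSpace M]
    [IsTopologicalAddGroup M] (x : X) (a : M) :
    VectorMeasure.dirac x (-a) = -VectorMeasure.dirac x a := by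
  ext s hs
  by_cases hx : x ∈ s <;> simp [hx, hs]

theorem integral_dirac_real {X : Type*} [MeasurableSpace X] [MeasurableSingletonClass X] (x : X)
    (m : ℝ) (f : X → ℝ) : ∫ᵛ y, f y ∂<•(VectorMeasure.dirac x m : SignedMeasure X) = m * f x := by
  simp [VectorMeasure.integral_dirac]

variable {N : ℕ}

theorem SeqNarrowLsc.lowerSemicontinuous_dirac {F : SignedMeasure (E N) → ℝ≥0∞}
    (hF : SeqNarrowLsc F) : LowerSemicontinuous fun p : E N × ℝ => F (.dirac p.1 p.2) := by
  refine lowerSemicontinuous_iff_isClosed_preimage.2 fun c =>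
    IsSeqClosed.isClosed fun q p hq hqp => ?_
  have hnarrow : NarrowTendsto (fun n => .dirac (q n).1 (q n).2) (.dirac p.1 p.2) := fun f => by
    simpa only [integral_dirac_real, Function.comp_apply] using
      hqp.snd_nhds.mul ((f.continuous.tendsto p.1).comp hqp.fst_nhds)
  exact (hF _ _ hnarrow).trans
    (liminf_le_of_frequently_le' (Eventually.of_forall hq).frequently)

theorem massAtom_dirac_le (H : E N × ℝ → ℝ≥0∞) (x : E N) (m : ℝ) :
    massAtom H (VectorMeasure.dirac x m) ≤ H (x, m) :=
  iInf_le_of_le {x} <| iInf_le_of_le (fun _ => m) <| iInf_le_of_le (by simp) (by simp)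

theorem massAtom_add_le {H : E N × ℝ → ℝ≥0∞} (hH : ∀ x, RayConcave fun m => H (x, m))
    (u v : SignedMeasure (E N)) : massAtom H (u + v) ≤ massAtom H u + massAtom H v := by
  classical
  simp only [massAtom, ENNReal.iInf_add, ENNReal.add_iInf]
  refine le_iInf fun t => le_iInf fun n => le_iInf fun hv =>
    le_iInf fun s => le_iInf fun m => le_iInf fun hu => ?_
  let k : E N → ℝ := fun x => (s : Set (E N)).indicator m x + (t : Set (E N)).indicator n x
  have hadd : u + v = ∑ x ∈ s ∪ t, VectorMeasure.dirac x (k x) := by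
    simp only [k, dirac_add, Finset.sum_add_distrib]
    rw [Finset.sum_indicator_subset_of_eq_zero m VectorMeasure.dirac Finset.subset_union_left
        fun _ => VectorMeasure.dirac_zero,
      Finset.sum_indicator_subset_of_eq_zero n VectorMeasure.dirac Finset.subset_union_right
        fun _ => VectorMeasure.dirac_zero, hu, hv]
  refine iInf_le_of_le (s ∪ t) <| iInf_le_of_le k <| iInf_le_of_le hadd ?_
  calc ∑ x ∈ s ∪ t, H (x, k x)
      ≤ ∑ x ∈ s ∪ t, (H (x, (s : Set (E N)).indicator m x)
          + H (x, (t : Set (E N)).indicator n x)) :=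
        Finset.sum_le_sum fun x _ => (hH x).add_le _ _
    _ = ∑ x ∈ s, H (x, m x) + ∑ x ∈ t, H (x, n x) := by
        rw [Finset.sum_add_distrib,
          Finset.sum_indicator_subset_of_eq_zero m (fun x a => H (x, a)) Finset.subset_union_left
            fun x => (hH x).map_zero,
          Finset.sum_indicator_subset_of_eq_zero n (fun x a => H (x, a)) Finset.subset_union_right
            fun x => (hH x).map_zero]

theorem seqNarrowLscEnvelope_massAtom_dirac_le (H : E N × ℝ → ℝ≥0∞) (x : E N) (m : ℝ) :
    seqNarrowLscEnvelope (massAtom H) (VectorMeasure.dirac x m) ≤ lscEnvelope H (x, m) :=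
  le_lscEnvelope
    (fun p => (seqNarrowLscEnvelope_le (massAtom H) _).trans (massAtom_dirac_le H p.1 p.2))
    (seqNarrowLsc_seqNarrowLscEnvelope (massAtom H)).lowerSemicontinuous_dirac (x, m)

end Dirac

/-! ### Discretization of a measure -/

section Discretization

theorem exists_measurable_index_dist_le (X : Type*) [PseudoMetricSpace X]
    [TopologicalSpace.SeparableSpace X] [MeasurableSpace X] [OpensMeasurableSpace X] {r : ℝ}
    (hr : 0 < r) : ∃ i : X → ℕ, Measurable i ∧ ∀ y z, i y = i z → dist y z ≤ r := by
  obtain ⟨A, hmeas, hbdd, hdiam, hcover, hdisj⟩ :=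
    SeparableSpace.exists_measurable_partition_diam_le X hr
  choose i hi using fun z => mem_iUnion.1 (hcover.symm ▸ mem_univ z)
  refine ⟨i, measurable_to_countable' fun n => ?_, fun y z hyz => ?_⟩
  · have hfiber : i ⁻¹' {n} = A n := by
      ext z
      refine ⟨fun h => h ▸ hi z, fun h => ?_⟩
      by_contra hne
      exact disjoint_left.1 (hdisj hne) (hi z) h
    exact hfiber ▸ hmeas n
  · exact (Metric.dist_le_diam_of_mem (hbdd _) (hi y) (hyz ▸ hi z)).trans (hdiam _)

variable {X ι : Type*} [MeasurableSpace X]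

theorem exists_tags_mul_measure_fiber_le [Nonempty X] (μ : Measure X) [IsFiniteMeasure μ]
    (i : X → ι) {g : X → ℝ≥0∞} (hg : AEMeasurable g μ) :
    ∃ x : ι → X, (∀ z, i (x (i z)) = i z) ∧
      ∀ n, g (x n) * μ (i ⁻¹' {n}) ≤ ∫⁻ z in i ⁻¹' {n}, g z ∂μ := by
  have htag : ∀ n, ∃ x, (n ∈ range i → i x = n) ∧
      g x * μ (i ⁻¹' {n}) ≤ ∫⁻ z in i ⁻¹' {n}, g z ∂μ := by
    intro n
    rcases eq_or_ne (μ (i ⁻¹' {n})) 0 with hnull | hpos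
    · by_cases hn : n ∈ range i
      · obtain ⟨x, rfl⟩ := hn
        exact ⟨x, fun _ => rfl, by simp [hnull]⟩
      · exact ⟨Classical.arbitrary X, fun h => (hn h).elim, by simp [hnull]⟩
    · obtain ⟨x, hx, hle⟩ := exists_le_setLAverage hpos (measure_ne_top _ _) hg.restrict
      rw [setLAverage_eq, ENNReal.le_div_iff_mul_le (.inl hpos) (.inl (measure_ne_top _ _))] at hle
      exact ⟨x, fun _ => hx, hle⟩
  choose x hx hle using htag
  exact ⟨x, fun z => hx _ (mem_range_self z), hle⟩

variable [Countable ι] [MeasurableSpace ι] [MeasurableSingletonClass ι] {i : X → ι}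

theorem tsum_setLIntegral_fiber (μ : Measure X) (hi : Measurable i) (g : X → ℝ≥0∞) :
    ∑' n, ∫⁻ z in i ⁻¹' {n}, g z ∂μ = ∫⁻ z, g z ∂μ := by
  rw [← lintegral_iUnion (fun n => hi (measurableSet_singleton n))
    (pairwise_disjoint_fiber i), ← preimage_iUnion, iUnion_of_singleton, preimage_univ,
    setLIntegral_univ]

theorem hasSum_measureReal_fiber_mul (μ : Measure X) [IsFiniteMeasure μ] (hi : Measurable i)
    (f : ι → ℝ) (hf : Integrable (fun z => f (i z)) μ) :
    HasSum (fun n => μ.real (i ⁻¹' {n}) * f n) (∫ z, f (i z) ∂μ) := by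
  have h := hasSum_integral_iUnion (fun n => hi (measurableSet_singleton n))
    (pairwise_disjoint_fiber i) hf.integrableOn
  rw [← preimage_iUnion, iUnion_of_singleton, preimage_univ, setIntegral_univ] at h
  refine h.congr_fun fun n => ?_
  rw [setIntegral_congr_fun (g := fun _ => f n) (hi (measurableSet_singleton n))
    fun z hz => congrArg f hz]
  simp

end Discretization

/-! ### The upper bound -/

section UpperBound

theorem hasSum_integral_restrict_of_countable {X : Type*} [TopologicalSpace X] [MeasurableSpace X]
    [OpensMeasurableSpace X] [MeasurableSingletonClass X] (u : SignedMeasure X) (f : X →ᵇ ℝ)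
    {A : Set X} (hA : A.Countable) :
    HasSum (fun x : A => u {(x : X)} * f x) (∫ᵛ x, f x ∂<•(u.restrict A)) := by
  have : Countable A := hA.to_subtype
  have hpositive : ∀ (μ : Measure X) [IsFiniteMeasure μ],
      HasSum (fun x : A => μ.real {(x : X)} * f x) (∫ x in A, f x ∂μ) := by
    intro μ _
    have h := hasSum_integral_iUnion (μ := μ) (f := f) (s := fun x : A => {(x : X)})
      (fun x => measurableSet_singleton _)
      (fun x y hxy => by simpa [Function.onFun, Subtype.coe_inj] using hxy)
      (f.integrable μ).integrableOn
    simpa [iUnion_of_singleton_coe, integral_singleton, measureReal_def] using h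
  rw [integral_eq_integral_posPart_sub, posPart_restrict _ hA.measurableSet,
    negPart_restrict _ hA.measurableSet]
  simpa only [apply_singleton, sub_mul] using (hpositive (posPart u)).sub (hpositive (negPart u))

variable {N : ℕ} {Ψ : SignedMeasure (E N) → ℝ≥0∞}

theorem SeqNarrowLsc.le_tsum_dirac (hΨ : SeqNarrowLsc Ψ) (h0 : Ψ 0 ≤ 0)
    (hadd : ∀ u v, Ψ (u + v) ≤ Ψ u + Ψ v) {ι : Type*} [Countable ι] {x : ι → E N} {m : ι → ℝ}
    {u : SignedMeasure (E N)}
    (hu : ∀ f : E N →ᵇ ℝ, HasSum (fun i => m i * f (x i)) (∫ᵛ y, f y ∂<•u)) :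
    Ψ u ≤ ∑' i, Ψ (.dirac (x i) (m i)) := by
  obtain ⟨T, hT⟩ := exists_seq_tendsto (atTop : Filter (Finset ι))
  have hnarrow : NarrowTendsto (fun n => ∑ i ∈ T n, .dirac (x i) (m i)) u := fun f => by
    simpa only [Function.comp_def, VectorMeasure.integral_finsetSum_vectorMeasure
      fun _ _ => vectorMeasure_integrable _ f, integral_dirac_real] using (hu f).comp hT
  calc Ψ u ≤ liminf (fun n => Ψ (∑ i ∈ T n, .dirac (x i) (m i))) atTop := hΨ _ _ hnarrow
    _ ≤ liminf (fun _ : ℕ => ∑' i, Ψ (.dirac (x i) (m i))) atTop :=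
        liminf_le_liminf <| Eventually.of_forall fun n =>
          (Finset.le_sum_of_subadditive Ψ h0 hadd _ _).trans (ENNReal.sum_le_tsum _)
    _ = ∑' i, Ψ (.dirac (x i) (m i)) := liminf_const _

theorem SeqNarrowLsc.restrict_atoms_le (hΨ : SeqNarrowLsc Ψ) (h0 : Ψ 0 ≤ 0)
    (hadd : ∀ u v, Ψ (u + v) ≤ Ψ u + Ψ v) (u : SignedMeasure (E N)) :
    Ψ (u.restrict (atoms u)) ≤ ∫⁻ x, Ψ (.dirac x (u {x})) ∂Measure.count := by
  have : Countable (atoms u) := (countable_atoms u).to_subtype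
  rw [lintegral_count]
  exact (hΨ.le_tsum_dirac h0 hadd
    fun f => hasSum_integral_restrict_of_countable u f (countable_atoms u)).trans
    (ENNReal.tsum_comp_le_tsum_of_injective Subtype.val_injective _)

theorem SeqNarrowLsc.map_le_lintegral (hΨ : SeqNarrowLsc Ψ) (h0 : Ψ 0 ≤ 0)
    (hadd : ∀ u v, Ψ (u + v) ≤ Ψ u + Ψ v) {g : E N → ℝ≥0∞}
    (hg : ∀ x m, 0 ≤ m → Ψ (.dirac x m) ≤ g x * ENNReal.ofReal m) (μ : Measure (E N))
    [IsFiniteMeasure μ] {i : E N → ℕ} (hi : Measurable i) {x : ℕ → E N}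
    (hle : ∀ n, g (x n) * μ (i ⁻¹' {n}) ≤ ∫⁻ z in i ⁻¹' {n}, g z ∂μ) :
    Ψ (μ.map (x ∘ i)).toSignedMeasure ≤ ∫⁻ z, g z ∂μ := by
  have hx : Measurable (x ∘ i) := (measurable_of_countable x).comp hi
  have hsum : ∀ f : E N →ᵇ ℝ, HasSum (fun n => μ.real (i ⁻¹' {n}) * f (x n))
      (∫ᵛ y, f y ∂<•(μ.map (x ∘ i)).toSignedMeasure) := fun f => by
    rw [VectorMeasure.integral_toSignedMeasure,
      integral_map hx.aemeasurable f.continuous.aestronglyMeasurable]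
    exact hasSum_measureReal_fiber_mul μ hi (fun n => f (x n))
      ((f.integrable (μ.map (x ∘ i))).comp_measurable hx)
  calc Ψ (μ.map (x ∘ i)).toSignedMeasure
      ≤ ∑' n, Ψ (.dirac (x n) (μ.real (i ⁻¹' {n}))) := hΨ.le_tsum_dirac h0 hadd hsum
    _ ≤ ∑' n, ∫⁻ z in i ⁻¹' {n}, g z ∂μ := ENNReal.tsum_le_tsum fun n =>
        ((hg _ _ measureReal_nonneg).trans_eq (by rw [ofReal_measureReal])).trans (hle n)
    _ = ∫⁻ z, g z ∂μ := tsum_setLIntegral_fiber μ hi g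

theorem narrowTendsto_map_toSignedMeasure (μ : Measure (E N)) [IsFiniteMeasure μ]
    {q : ℕ → E N → E N} (hq : ∀ n, Measurable (q n))
    (hlim : ∀ z, Tendsto (fun n => q n z) atTop (𝓝 z)) :
    NarrowTendsto (fun n => (μ.map (q n)).toSignedMeasure) μ.toSignedMeasure := fun f => by
  simp only [VectorMeasure.integral_toSignedMeasure,
    fun n => integral_map (hq n).aemeasurable f.continuous.aestronglyMeasurable (μ := μ)]
  exact tendsto_integral_of_dominated_convergence (fun _ => ‖f‖)
    (fun n => (f.continuous.measurable.comp (hq n)).aestronglyMeasurable) (integrable_const _)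
    (fun n => Eventually.of_forall fun z => f.norm_coe_le_norm _)
    (Eventually.of_forall fun z => (f.continuous.tendsto z).comp (hlim z))

theorem SeqNarrowLsc.toSignedMeasure_le_lintegral (hΨ : SeqNarrowLsc Ψ) (h0 : Ψ 0 ≤ 0)
    (hadd : ∀ u v, Ψ (u + v) ≤ Ψ u + Ψ v) {g : E N → ℝ≥0∞} (hmeas : Measurable g)
    (hg : ∀ x m, 0 ≤ m → Ψ (.dirac x m) ≤ g x * ENNReal.ofReal m) (μ : Measure (E N))
    [IsFiniteMeasure μ] : Ψ μ.toSignedMeasure ≤ ∫⁻ z, g z ∂μ := by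
  choose i hi hdist using fun n : ℕ =>
    exists_measurable_index_dist_le (E N) (Nat.one_div_pos_of_nat (α := ℝ) (n := n))
  choose x hx hle using fun n => exists_tags_mul_measure_fiber_le μ (i n) hmeas.aemeasurable
  have hlim : ∀ z, Tendsto (fun n => x n (i n z)) atTop (𝓝 z) := fun z =>
    tendsto_iff_dist_tendsto_zero.2 <| squeeze_zero (fun _ => dist_nonneg)
      (fun n => hdist n _ _ (hx n z)) tendsto_one_div_add_atTop_nhds_zero_nat
  calc Ψ μ.toSignedMeasure
      ≤ liminf (fun n => Ψ (μ.map (x n ∘ i n)).toSignedMeasure) atTop :=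
        hΨ _ _ (narrowTendsto_map_toSignedMeasure μ
          (fun n => (measurable_of_countable (x n)).comp (hi n)) hlim)
    _ ≤ liminf (fun _ : ℕ => ∫⁻ z, g z ∂μ) atTop :=
        liminf_le_liminf <| Eventually.of_forall fun n =>
          hΨ.map_le_lintegral h0 hadd hg μ (hi n) (hle n)
    _ = ∫⁻ z, g z ∂μ := liminf_const _

theorem SeqNarrowLsc.le_massH (hΨ : SeqNarrowLsc Ψ) (hadd : ∀ u v, Ψ (u + v) ≤ Ψ u + Ψ v)
    {K : E N × ℝ → ℝ≥0∞} (hK : ∀ x, RayConcave fun m => K (x, m)) (hlsc : LowerSemicontinuous K)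
    (hΨK : ∀ x m, Ψ (.dirac x m) ≤ K (x, m)) : Ψ ≤ massH K := by
  intro u
  have h0 : Ψ 0 ≤ 0 := by simpa [(hK 0).map_zero] using hΨK 0 0
  have hdecomp : u = u.restrict (atoms u) + (posPart (diffusePart u)).toSignedMeasure
      + -(negPart (diffusePart u)).toSignedMeasure := by
    rw [add_assoc, ← sub_eq_add_neg, posPart_sub_negPart, diffusePart,
      VectorMeasure.restrict_add_restrict_compl (measurableSet_atoms u)]
  have hatoms := (hΨ.restrict_atoms_le h0 hadd u).trans
    (lintegral_mono fun x => hΨK x (u {x}))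
  have hpos := hΨ.toSignedMeasure_le_lintegral h0 hadd
    (lowerSemicontinuous_secantSlope hlsc le_rfl).measurable
    (fun x m hm => (hΨK x m).trans ((hK x).le_secantSlope_zero_mul hm))
    (posPart (diffusePart u))
  have hneg := SeqNarrowLsc.toSignedMeasure_le_lintegral (Ψ := fun v => Ψ (-v))
    (fun v w hv => hΨ _ _ hv.neg) (by simpa using h0)
    (fun v w => by simpa only [neg_add] using hadd (-v) (-w))
    (lowerSemicontinuous_secantSlope (lowerSemicontinuous_reflect hlsc) le_rfl).measurable
    (fun x m hm => by
      rw [← dirac_neg]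
      exact (hΨK x (-m)).trans ((hK x).comp_neg.le_secantSlope_zero_mul hm))
    (negPart (diffusePart u))
  simp only [massH, rightSlope_eq_secantSlope (hK _), leftSlope_eq_secantSlope (hK _)]
  calc Ψ u ≤ Ψ (u.restrict (atoms u)) + Ψ (posPart (diffusePart u)).toSignedMeasure
        + Ψ (-(negPart (diffusePart u)).toSignedMeasure) := by
        conv_lhs => rw [hdecomp]
        exact (hadd _ _).trans (by gcongr; exact hadd _ _)
    _ ≤ _ := add_le_add (add_le_add hatoms hpos) hneg

end UpperBound

end HMass

end

theorem mainTheorem6_general {N : ℕ} (H : HMass.E N × ℝ → ℝ≥0∞)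
    (hH : ∀ x, HMass.RayConcave fun m => H (x, m)) :
    HMass.IsAdmissible (HMass.lscEnvelope H) ∧
      HMass.massH (HMass.lscEnvelope H) = HMass.seqNarrowLscEnvelope (HMass.massAtom H) := by
  have hlsc := HMass.lowerSemicontinuous_lscEnvelope H
  have hK := HMass.rayConcave_lscEnvelope hH
  refine ⟨HMass.isAdmissible_of_rayConcave hlsc.measurable hK, le_antisymm ?_ ?_⟩
  · exact HMass.le_seqNarrowLscEnvelope
      (HMass.massH_le_massAtom (fun x => (hK x).map_zero) (HMass.lscEnvelope_le H))
      (HMass.seqNarrowLsc_massH hK hlsc)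
  · exact (HMass.seqNarrowLsc_seqNarrowLscEnvelope (HMass.massAtom H)).le_massH
      (HMass.seqNarrowLscEnvelope_add_le (HMass.massAtom_add_le hH)) hK hlsc
      (HMass.seqNarrowLscEnvelope_massAtom_dirac_le H)

theorem mainTheorem6 {N : ℕ} (H : HMass.E N × ℝ → ℝ≥0∞) (hconc : HMass.MassConcave H)
    (hzero : ∀ x, H (x, 0) = 0) :
    HMass.IsAdmissible (HMass.lscEnvelope H) ∧
      HMass.massH (HMass.lscEnvelope H) = HMass.seqNarrowLscEnvelope (HMass.massAtom H) :=
  mainTheorem6_general H fun x => .of_concaveOn (hzero x) (hconc x).1 (hconc x).2
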